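/- **Theorem 1.3.** Let $n\ge 3$, let $N=\binom n2$, and let $e_1,\dots,e_N$ be a uniformly random ordering of the edges of the complete graph $K_n$ on a vertex set $V$ with $|V|=n$. For $0\le m\le N$ let $G_m$ be the graph on $V$ with edge set $\{e_1,\dots,e_m\}$, let $m^*=\min\{m:\delta(G_m)\ge 2\}$, where $\delta$ denotes the minimum degree, and call $G_{m^*}$ the Bollobás random graph. Let $v$ be a uniformly random vertex in $V$, chosen independently of the ordering. Then for every $c_0>0$ there is an $n_0$ such that for all $n\ge n_0$ and all real $c\ge c_0$, $$\Pr\bigl(\deg_{G_{m^*}}(v)=2\bigr)\;\le\;\frac{\log\bigl(c\,n(\log n)^2\bigr)}{2n},$$ where $\log$ is the natural logarithm and the probability is over both the ordering of the edges and the choice of $v$. In particular, the bound holds for each fixed $c>0$ and all sufficiently large $n$, and for all sufficiently large $n$ when $c=c(n)\to\infty$. -/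

import Mathlib

/-- The edges of the complete graph on the vertex set `Fin n`. -/
abbrev CompleteEdge (n : ℕ) : Type := (⊤ : SimpleGraph (Fin n)).edgeSet

/-- An enumeration `e_1, …, e_N` of all the edges of `K_n`, where `N = n.choose 2`
(the edge `e_{i+1}` is `σ i`). -/
abbrev EdgeOrdering (n : ℕ) : Type := Fin (n.choose 2) ≃ CompleteEdge n

/-- The graph `G_m` on `Fin n` whose edges are the first `m` edges of the enumeration `σ`. -/
def edgeProcess {n : ℕ} (σ : EdgeOrdering n) (m : ℕ) : SimpleGraph (Fin n) :=
  SimpleGraph.fromEdgeSet {e | ∃ i : Fin (n.choose 2), (i : ℕ) < m ∧ (σ i : Sym2 (Fin n)) = e}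

open Classical in
/-- The hitting time `m* = min {m : δ(G_m) ≥ 2}`. For `n ≥ 3` the set is non-empty, since
`G_N = K_n` has minimum degree `n - 1`. -/
noncomputable def hittingTime {n : ℕ} (σ : EdgeOrdering n) : ℕ :=
  sInf {m : ℕ | 2 ≤ (edgeProcess σ m).minDegree}

/-- The graph `G_{m*}` determined by the enumeration `σ`. -/
noncomputable def bollobasGraph {n : ℕ} (σ : EdgeOrdering n) : SimpleGraph (Fin n) :=
  edgeProcess σ (hittingTime σ)

/-- The probability of the event `A` under the uniform distribution on the finite type `Ω`. -/
noncomputable def uniformProb (Ω : Type) [Finite Ω] (A : Set Ω) : ℝ :=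
  (A.ncard : ℝ) / (Nat.card Ω : ℝ)

open Classical in
/-- The probability that a uniformly random vertex `v` of `G_{m*}`, chosen independently of the
uniformly random ordering of the edges of `K_n` that determines `G_{m*}`, has exactly two edges
of `G_{m*}` incident to it. -/
noncomputable def probDegreeTwo (n : ℕ) : ℝ :=
  uniformProb (EdgeOrdering n × Fin n) {p | (bollobasGraph p.1).degree p.2 = 2}

open MeasureTheory Finset
open scoped ENNReal

/-! Give the edges independent uniform times on [0,1]; their order is a uniformly random ordering
(`uniformProb_le_uniformTimes`). Fix v and let M be `othersTime`, the time at which K_n - v reaches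
minimum degree two; M is independent of the times of the edges at v. If v has degree two in the
Bollobás graph, then at some time t it has degree at most two while all other vertices have degree
at least two.

If t ≥ M, then v has at most two edges at time M. The events "at most one" are disjoint for distinct
v, so their probabilities sum to at most 1 (`sum_measure_le_one`); by the binomial law, "exactly
two" is larger by a factor of at most about nτ/2 as long as M ≤ τ (`measure_eq_two_le`). If M > τ,
two vertices have few edges at time τ; for nτ = log n + (3/2) log log n this contributes O(1) in
total. If t < M, the last vertex to finish in K_n - v is joined to v by one of the first two edges
at v, which has probability at most 2/(n-1) (`measure_earlyLinkEvent`).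

The expected number of degree-two vertices is thus at most (log n)/2 + (3/4) log log n + O(1), while
the target is (log n)/2 + log log n + O(1). -/

/-- The uniform distribution on the unit interval, as a measure on `ℝ`. -/
noncomputable def unitUniform : Measure ℝ := volume.restrict (Set.Icc 0 1)

instance isProbabilityMeasure_unitUniform : IsProbabilityMeasure unitUniform :=
  ⟨by simp [unitUniform]⟩

/-- The law of a family of independent uniform times indexed by `E`. -/
noncomputable def uniformTimes (E : Type*) [Fintype E] : Measure (E → ℝ) :=
  Measure.pi fun _ => unitUniform

instance isProbabilityMeasure_uniformTimes (E : Type*) [Fintype E] :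
    IsProbabilityMeasure (uniformTimes E) := by
  unfold uniformTimes; infer_instance

lemma unitUniform_Iic {t : ℝ} (h1 : t ≤ 1) :
    unitUniform (Set.Iic t) = ENNReal.ofReal t := by
  have : Set.Iic t ∩ Set.Icc 0 1 = Set.Icc 0 t := by
    ext x; simp only [Set.mem_inter_iff, Set.mem_Iic, Set.mem_Icc]; constructor
    · rintro ⟨h, h', -⟩; exact ⟨h', h⟩
    · rintro ⟨h, h'⟩; exact ⟨h', h, h'.trans h1⟩
  rw [unitUniform, Measure.restrict_apply measurableSet_Iic, this, Real.volume_Icc, sub_zero]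

lemma unitUniform_Ioi {t : ℝ} (h0 : 0 ≤ t) :
    unitUniform (Set.Ioi t) = ENNReal.ofReal (1 - t) := by
  have : Set.Ioi t ∩ Set.Icc 0 1 = Set.Ioc t 1 := by
    ext x; simp only [Set.mem_inter_iff, Set.mem_Ioi, Set.mem_Icc, Set.mem_Ioc]; constructor
    · rintro ⟨h, -, h'⟩; exact ⟨h, h'⟩
    · rintro ⟨h, h'⟩; exact ⟨h, h0.trans h.le, h'⟩
  rw [unitUniform, Measure.restrict_apply measurableSet_Ioi, this, Real.volume_Ioc]

lemma unitUniform_Iic_of_neg {t : ℝ} (h0 : t < 0) : unitUniform (Set.Iic t) = 0 := by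
  have : Set.Iic t ∩ Set.Icc 0 1 = ∅ := by
    ext x
    simp only [Set.mem_inter_iff, Set.mem_Iic, Set.mem_Icc, Set.mem_empty_iff_false, iff_false]
    rintro ⟨h, h', -⟩; linarith
  rw [unitUniform, Measure.restrict_apply measurableSet_Iic, this, measure_empty]

/-! ### Random orderings from independent uniform times -/

section Transfer

variable {E : Type*} [Fintype E]

lemma uniformTimes_reindex {F : Type*} [Fintype F] (σ : F ≃ E) :
    MeasurePreserving (fun U : E → ℝ => U ∘ σ) (uniformTimes E) (uniformTimes F) := by
  refine ⟨by fun_prop, ?_⟩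
  symm
  refine Measure.pi_eq fun s hs => ?_
  rw [Measure.map_apply (by fun_prop) (MeasurableSet.univ_pi hs)]
  have : (fun U : E → ℝ => U ∘ σ) ⁻¹' Set.univ.pi s = Set.univ.pi fun e => s (σ.symm e) := by
    ext U
    simp only [Set.mem_preimage, Set.mem_pi, Set.mem_univ, true_imp_iff, Function.comp]
    exact ⟨fun h e => by simpa using h (σ.symm e), fun h f => by simpa using h (σ f)⟩
  rw [this, uniformTimes, Measure.pi_pi]
  exact Fintype.prod_equiv σ.symm _ _ fun _ => rfl

lemma uniformTimes_absolutelyContinuous :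
    uniformTimes E ≪ (volume : Measure (E → ℝ)) := by
  have : uniformTimes E = volume.restrict (Set.univ.pi fun _ : E => Set.Icc (0 : ℝ) 1) := by
    rw [uniformTimes, volume_pi, Measure.restrict_pi_pi]; rfl
  rw [this]
  exact Measure.absolutelyContinuous_of_le Measure.restrict_le_self

/-- A tie confines `U` to a proper subspace, which is Lebesgue-null. -/
lemma ae_injective_uniformTimes : ∀ᵐ U ∂uniformTimes E, Function.Injective U := by
  classical
  have h : ∀ e f : E, e ≠ f → ∀ᵐ U ∂uniformTimes E, U e ≠ U f := by
    intro e f hef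
    apply uniformTimes_absolutelyContinuous.ae_le
    let L : (E → ℝ) →ₗ[ℝ] ℝ := LinearMap.proj (R := ℝ) (φ := fun _ : E => ℝ) e - LinearMap.proj (R := ℝ) (φ := fun _ : E => ℝ) f
    have hL : LinearMap.ker L ≠ ⊤ := by
      intro h
      have : Pi.single e (1 : ℝ) ∈ LinearMap.ker L := h ▸ Submodule.mem_top
      simp [L, hef.symm] at this
    have := Measure.addHaar_submodule (volume : Measure (E → ℝ)) _ hL
    refine measure_mono_null (fun U hU => ?_) this
    have hU' : U e = U f := not_not.mp hU
    simp [L, hU']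
  have h' : ∀ᵐ U ∂uniformTimes E, ∀ e f : E, e ≠ f → U e ≠ U f := by
    rw [ae_all_iff]; intro e
    rw [ae_all_iff]; intro f
    by_cases hef : e = f
    · simp [hef]
    · filter_upwards [h e f hef] with U hU _ using hU
  filter_upwards [h'] with U hU e f hef
  by_contra hne
  exact hU e f hne hef

lemma measurableSet_strictMono {k : ℕ} : MeasurableSet {f : Fin k → ℝ | StrictMono f} := by
  have : {f : Fin k → ℝ | StrictMono f} = ⋂ i, ⋂ j, {f | i < j → f i < f j} := by
    ext f; simp [StrictMono]
  rw [this]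
  refine MeasurableSet.iInter fun i => MeasurableSet.iInter fun j => ?_
  by_cases h : i < j
  · simpa [h] using measurableSet_lt (measurable_pi_apply i) (measurable_pi_apply j)
  · simp [h]

/-- `τ.symm ∘ σ` is an order automorphism of `Fin k`, and the identity is the only one. -/
lemma eq_of_strictMono_comp {E : Type*} {k : ℕ} {U : E → ℝ} {σ τ : Fin k ≃ E}
    (hσ : StrictMono (U ∘ σ)) (hτ : StrictMono (U ∘ τ)) : σ = τ := by
  have hmono : StrictMono (τ.symm ∘ σ) := by
    intro i j hij
    by_contra h
    have := hτ.monotone (not_lt.mp h)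
    simp only [Function.comp, Equiv.apply_symm_apply] at this
    exact absurd (hσ hij) (not_lt.mpr this)
  have hid : StrictMono.orderIsoOfSurjective _ hmono (τ.symm.surjective.comp σ.surjective) =
      OrderIso.refl _ := Subsingleton.elim _ _
  ext i
  have := congrArg (fun g : Fin k ≃o Fin k => g i) hid
  simp only [StrictMono.coe_orderIsoOfSurjective, Function.comp, OrderIso.refl_apply] at this
  rw [Equiv.symm_apply_eq] at this
  rw [this]

lemma exists_strictMono_comp {E : Type*} {k : ℕ} (τ : Fin k ≃ E) {U : E → ℝ} (hU : Function.Injective U) :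
    ∃ σ : Fin k ≃ E, StrictMono (U ∘ σ) := by
  refine ⟨(Tuple.sort (U ∘ τ)).trans τ, ?_⟩
  exact (Tuple.monotone_sort (U ∘ τ)).strictMono_of_injective
    ((hU.comp τ.injective).comp (Tuple.sort (U ∘ τ)).injective)

/-- The order of independent uniform times is a uniformly random ordering. -/
theorem uniformProb_le_uniformTimes {E : Type} [Fintype E] {k : ℕ} (τ : Fin k ≃ E)
    (A : Set (Fin k ≃ E)) (B : Set (E → ℝ))
    (hB : ∀ σ ∈ A, ∀ U : E → ℝ, StrictMono (U ∘ σ) → U ∈ B) :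
    uniformProb (Fin k ≃ E) A ≤ (uniformTimes E).real B := by
  classical
  -- By exchangeability all order regions have the same measure `c`; being disjoint and covering
  -- almost everything, they force `c` to be the reciprocal of the number of orderings.
  set c : ℝ≥0∞ := uniformTimes (Fin k) {f | StrictMono f} with hc
  let O : (Fin k ≃ E) → Set (E → ℝ) := fun σ => {U | StrictMono (U ∘ σ)}
  have hO : ∀ σ, uniformTimes E (O σ) = c := fun σ =>
    (uniformTimes_reindex σ).measure_preimage measurableSet_strictMono.nullMeasurableSet
  have hOm : ∀ σ, MeasurableSet (O σ) := fun σ =>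
    (uniformTimes_reindex σ).measurable measurableSet_strictMono
  have hdisj : ∀ S : Set (Fin k ≃ E), S.PairwiseDisjoint O := by
    intro S σ _ τ _ hne
    exact Set.disjoint_left.mpr fun U hσ hτ => hne (eq_of_strictMono_comp hσ hτ)
  have hsum : ∀ S : Finset (Fin k ≃ E), uniformTimes E (⋃ σ ∈ S, O σ) = #S * c := by
    intro S
    rw [measure_biUnion_finset (hdisj S) fun σ _ => hOm σ, Finset.sum_congr rfl fun σ _ => hO σ]
    simp
  have hone : (#(univ : Finset (Fin k ≃ E)) : ℝ≥0∞) * c = 1 := by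
    rw [← hsum, ← measure_univ (μ := uniformTimes E)]
    apply measure_congr
    filter_upwards [ae_injective_uniformTimes (E := E)] with U hU
    obtain ⟨σ, hσ⟩ := exists_strictMono_comp τ hU
    apply propext
    exact iff_of_true (Set.mem_iUnion₂.mpr ⟨σ, mem_univ σ, hσ⟩) trivial
  -- Only monotonicity of the measure is used, so `B` need not be measurable.
  have hle : (#(A.toFinset) : ℝ≥0∞) * c ≤ uniformTimes E B := by
    rw [← hsum]
    refine measure_mono fun U hU => ?_
    obtain ⟨σ, hσ, hσU⟩ := Set.mem_iUnion₂.mp hU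
    exact hB σ (by simpa using hσ) U hσU
  have hone' : (Nat.card (Fin k ≃ E) : ℝ) * c.toReal = 1 := by
    have := congrArg ENNReal.toReal hone
    simpa [Nat.card_eq_fintype_card] using this
  have hle' : (A.ncard : ℝ) * c.toReal ≤ (uniformTimes E).real B := by
    have := ENNReal.toReal_mono (measure_ne_top _ _) hle
    rw [ENNReal.toReal_mul, ENNReal.toReal_natCast] at this
    rwa [Set.ncard_eq_toFinset_card']
  have hpos : (0 : ℝ) < Nat.card (Fin k ≃ E) := by
    rw [Nat.cast_pos, Nat.card_pos_iff]; exact ⟨⟨τ⟩, inferInstance⟩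
  rw [uniformProb, div_le_iff₀ hpos]
  have : (A.ncard : ℝ) = (A.ncard : ℝ) * c.toReal * Nat.card (Fin k ≃ E) := by
    rw [mul_assoc, mul_comm c.toReal, hone', mul_one]
  rw [this]
  exact mul_le_mul_of_nonneg_right hle' hpos.le

end Transfer

/-! ### Arrival counts: independence, binomial law, ranks -/

section Arrivals

variable {E : Type*}

/-- The number of elements of `s` whose time is at most `t`. -/
noncomputable def arrivals (s : Finset E) (U : E → ℝ) (t : ℝ) : ℕ := #{e ∈ s | U e ≤ t}

lemma arrivals_mono {s s' : Finset E} (hs : s ⊆ s') (U : E → ℝ) {t t' : ℝ} (h : t ≤ t') :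
    arrivals s U t ≤ arrivals s' U t' := by
  refine card_le_card fun e he => ?_
  rw [mem_filter] at he ⊢
  exact ⟨hs he.1, he.2.trans h⟩

lemma arrivals_congr {s : Finset E} {U U' : E → ℝ} (h : ∀ e ∈ s, U e = U' e) (t : ℝ) :
    arrivals s U t = arrivals s U' t := by
  rw [arrivals, arrivals, filter_congr fun e he => by rw [h e he]]

lemma Measurable.arrivals {α : Type*} [MeasurableSpace α] (s : Finset E) {X : α → E → ℝ}
    {T : α → ℝ} (hX : Measurable X) (hT : Measurable T) :
    Measurable fun a => arrivals s (X a) (T a) := by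
  simp only [_root_.arrivals, card_filter]
  refine Finset.measurable_sum _ fun e _ => Measurable.ite ?_ measurable_const measurable_const
  exact measurableSet_le ((measurable_pi_apply e).comp hX) hT

/-- The second smallest of the times of the elements of `s`. -/
noncomputable def secondTime (s : Finset E) (U : E → ℝ) : ℝ :=
  if h : s.offDiag.Nonempty then s.offDiag.inf' h fun p => max (U p.1) (U p.2) else 0

lemma secondTime_le_iff {s : Finset E} (hs : 2 ≤ #s) {U : E → ℝ} {t : ℝ} :
    secondTime s U ≤ t ↔ 2 ≤ arrivals s U t := by
  have hne : s.offDiag.Nonempty := by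
    obtain ⟨a, ha, b, hb, hab⟩ := one_lt_card.mp hs
    exact ⟨(a, b), mem_offDiag.mpr ⟨ha, hb, hab⟩⟩
  rw [secondTime, dif_pos hne, inf'_le_iff, arrivals, Nat.succ_le_iff, one_lt_card]
  constructor
  · rintro ⟨p, hp, hpt⟩
    rw [mem_offDiag] at hp
    rw [max_le_iff] at hpt
    exact ⟨p.1, mem_filter.mpr ⟨hp.1, hpt.1⟩, p.2, mem_filter.mpr ⟨hp.2.1, hpt.2⟩, hp.2.2⟩
  · rintro ⟨a, ha, b, hb, hab⟩
    rw [mem_filter] at ha hb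
    exact ⟨(a, b), mem_offDiag.mpr ⟨ha.1, hb.1, hab⟩, max_le ha.2 hb.2⟩

lemma secondTime_congr {s : Finset E} {U U' : E → ℝ} (h : ∀ e ∈ s, U e = U' e) :
    secondTime s U = secondTime s U' := by
  unfold secondTime
  split_ifs with hne
  · refine inf'_congr hne rfl fun p hp => ?_
    rw [mem_offDiag] at hp
    rw [h _ hp.1, h _ hp.2.1]
  · rfl

lemma measurable_secondTime {s : Finset E} (hs : 2 ≤ #s) : Measurable (secondTime s) := by
  refine measurable_of_Iic fun t => ?_
  have : secondTime s ⁻¹' Set.Iic t = {U | 2 ≤ arrivals s U t} := by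
    ext U; exact secondTime_le_iff hs
  rw [this]
  exact measurableSet_le measurable_const (measurable_id.arrivals s measurable_const)

variable [DecidableEq E] [Fintype E]

/-- Splicing two independent samples yields one sample; this encodes the independence of the
coordinates inside and outside `s`. -/
lemma uniformTimes_resample (s : Finset E) :
    MeasurePreserving (fun z : (E → ℝ) × (E → ℝ) => s.piecewise z.1 z.2)
      ((uniformTimes E).prod (uniformTimes E)) (uniformTimes E) := by
  have hm : Measurable fun z : (E → ℝ) × (E → ℝ) => s.piecewise z.1 z.2 := by
    refine measurable_pi_lambda _ fun e => ?_
    by_cases he : e ∈ s <;> simp only [he, piecewise_eq_of_mem, piecewise_eq_of_notMem,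
      not_false_eq_true] <;> fun_prop
  refine ⟨hm, ?_⟩
  symm
  refine Measure.pi_eq fun A hA => ?_
  rw [Measure.map_apply hm (MeasurableSet.univ_pi hA)]
  have : (fun z : (E → ℝ) × (E → ℝ) => s.piecewise z.1 z.2) ⁻¹' Set.univ.pi A =
      (Set.univ.pi fun e => if e ∈ s then A e else Set.univ) ×ˢ
        (Set.univ.pi fun e => if e ∈ s then Set.univ else A e) := by
    ext z
    simp only [Set.mem_preimage, Set.mem_pi, Set.mem_univ, true_imp_iff, Set.mem_prod,
      ← forall_and]
    refine forall_congr' fun e => ?_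
    by_cases he : e ∈ s <;> simp [he]
  rw [this, Measure.prod_prod, uniformTimes, Measure.pi_pi, Measure.pi_pi, ← prod_mul_distrib]
  refine prod_congr rfl fun e _ => ?_
  by_cases he : e ∈ s <;> simp [he]

/-- Fubini for an event in which the first argument matters only through the coordinates in `s`
and the second only through those outside `s`. -/
lemma uniformTimes_diag (s : Finset E) {S : Set ((E → ℝ) × (E → ℝ))} (hS : MeasurableSet S)
    (hdep : ∀ x x' y y' : E → ℝ, (∀ e ∈ s, x e = x' e) → (∀ e ∉ s, y e = y' e) →
      ((x, y) ∈ S ↔ (x', y') ∈ S)) :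
    uniformTimes E {U | (U, U) ∈ S} =
      ∫⁻ y, uniformTimes E {x | (x, y) ∈ S} ∂uniformTimes E := by
  have hdiag : MeasurableSet {U : E → ℝ | (U, U) ∈ S} :=
    (measurable_id.prodMk measurable_id) hS
  rw [← (uniformTimes_resample s).measure_preimage hdiag.nullMeasurableSet]
  have : (fun z : (E → ℝ) × (E → ℝ) => s.piecewise z.1 z.2) ⁻¹' {U | (U, U) ∈ S} = S := by
    ext ⟨x, y⟩
    exact hdep _ _ _ _ (fun e he => piecewise_eq_of_mem _ _ _ he)
      fun e he => piecewise_eq_of_notMem _ _ _ he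
  rw [this, Measure.prod_apply_symm hS]
  rfl

lemma uniformTimes_inter {s s' : Finset E} (h : Disjoint s s') (t : ℝ) (k k' : ℕ) :
    uniformTimes E {U | arrivals s U t ≤ k ∧ arrivals s' U t ≤ k'} =
      uniformTimes E {U | arrivals s U t ≤ k} * uniformTimes E {U | arrivals s' U t ≤ k'} := by
  have hm : ∀ (s : Finset E) (k : ℕ), MeasurableSet {U : E → ℝ | arrivals s U t ≤ k} := fun s k =>
    measurableSet_le (measurable_id.arrivals s measurable_const) measurable_const
  have := uniformTimes_diag s ((hm s k).prod (hm s' k')) (by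
    intro x x' y y' hx hy
    simp only [Set.mem_prod, Set.mem_ofPred_eq]
    rw [arrivals_congr hx, arrivals_congr fun e he => hy e (disjoint_right.mp h he)])
  simp only [Set.mem_prod, Set.mem_ofPred_eq] at this
  rw [this]
  have h2 : ∀ y : E → ℝ, uniformTimes E {x | arrivals s x t ≤ k ∧ arrivals s' y t ≤ k'} =
      {y | arrivals s' y t ≤ k'}.indicator
        (fun _ => uniformTimes E {x | arrivals s x t ≤ k}) y := by
    intro y
    by_cases hy : arrivals s' y t ≤ k' <;> simp [hy]
  simp only [h2]
  rw [lintegral_indicator_const (hm s' k')]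

/-- Once the set `A` of arrived elements is fixed, the event is a box, so its measure is a product.
-/
lemma uniformTimes_arrivals_eq (s : Finset E) {t : ℝ} (h0 : 0 ≤ t) (h1 : t ≤ 1) (j : ℕ) :
    uniformTimes E {U | arrivals s U t = j} =
      ENNReal.ofReal ((#s).choose j * (t ^ j * (1 - t) ^ (#s - j))) := by
  let R : Finset E → Set (E → ℝ) := fun A =>
    Set.univ.pi fun e => if e ∈ A then Set.Iic t else if e ∈ s then Set.Ioi t else Set.univ
  have hR : ∀ A ⊆ s, ∀ U : E → ℝ, U ∈ R A ↔ {e ∈ s | U e ≤ t} = A := by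
    intro A hA U
    simp only [R, Set.mem_pi, Set.mem_univ, true_imp_iff, Finset.ext_iff, mem_filter]
    refine forall_congr' fun e => ?_
    by_cases heA : e ∈ A
    · simp [heA, hA heA]
    · by_cases hes : e ∈ s <;> simp [heA, hes]
  have hset : {U : E → ℝ | arrivals s U t = j} = ⋃ A ∈ s.powersetCard j, R A := by
    ext U
    simp only [Set.mem_ofPred_eq, Set.mem_iUnion, mem_powersetCard, exists_prop]
    constructor
    · intro h
      exact ⟨_, ⟨filter_subset _ _, h⟩, (hR _ (filter_subset _ _) U).mpr rfl⟩
    · rintro ⟨A, ⟨hA, hc⟩, hU⟩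
      rw [arrivals, (hR A hA U).mp hU, hc]
  have hdisj : (↑(s.powersetCard j) : Set (Finset E)).PairwiseDisjoint R := by
    intro A hA B hB hne
    refine Set.disjoint_left.mpr fun U hUA hUB => hne ?_
    rw [mem_coe, mem_powersetCard] at hA hB
    rw [← (hR A hA.1 U).mp hUA, (hR B hB.1 U).mp hUB]
  have hmeas : ∀ A ∈ s.powersetCard j, MeasurableSet (R A) := fun A _ =>
    MeasurableSet.univ_pi fun e => by split_ifs <;> measurability
  have hval : ∀ A ∈ s.powersetCard j, uniformTimes E (R A) =
      ENNReal.ofReal (t ^ j * (1 - t) ^ (#s - j)) := by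
    intro A hA
    rw [mem_powersetCard] at hA
    have : ∀ e, unitUniform (if e ∈ A then Set.Iic t else if e ∈ s then Set.Ioi t else Set.univ) =
        (if e ∈ A then ENNReal.ofReal t else 1) *
          (if e ∈ s \ A then ENNReal.ofReal (1 - t) else 1) := by
      intro e
      by_cases heA : e ∈ A
      · simp [heA, unitUniform_Iic h1]
      · by_cases hes : e ∈ s <;> simp [heA, hes, unitUniform_Ioi h0]
    rw [uniformTimes, Measure.pi_pi, prod_congr rfl fun e _ => this e, prod_mul_distrib]
    simp only [prod_ite_mem, univ_inter, prod_const]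
    rw [card_sdiff_of_subset hA.1, hA.2, ENNReal.ofReal_mul (by positivity),
      ENNReal.ofReal_pow h0, ENNReal.ofReal_pow (by linarith)]
  rw [hset, measure_biUnion_finset hdisj hmeas, sum_congr rfl hval, sum_const, card_powersetCard,
    nsmul_eq_mul, ENNReal.ofReal_mul (Nat.cast_nonneg _), ENNReal.ofReal_natCast]

/-- Needed because `othersTime`, later substituted for `t`, has no sign pointwise. -/
lemma uniformTimes_arrivals_eq_zero_of_neg (s : Finset E) {t : ℝ} (ht : t < 0) {j : ℕ}
    (hj : j ≠ 0) : uniformTimes E {U | arrivals s U t = j} = 0 := by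
  have hnull : ∀ e : E, uniformTimes E {U | U e ≤ t} = 0 := by
    intro e
    have : {U : E → ℝ | U e ≤ t} =
        Set.univ.pi fun f => if f = e then Set.Iic t else Set.univ := by
      ext U
      simp only [Set.mem_ofPred_eq, Set.mem_pi, Set.mem_univ, true_imp_iff]
      constructor
      · intro h f
        split_ifs with hf
        · rw [hf]; exact h
        · trivial
      · intro h; simpa using h e
    rw [this, uniformTimes, Measure.pi_pi]
    exact prod_eq_zero (mem_univ e) (by simp [unitUniform_Iic_of_neg ht])
  refine measure_mono_null (t := ⋃ e : E, {U | U e ≤ t}) (fun U hU => ?_)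
    (measure_iUnion_null hnull)
  have hpos : 0 < #{e ∈ s | U e ≤ t} := by
    have : arrivals s U t = j := hU
    rw [arrivals] at this; omega
  obtain ⟨e, he⟩ := card_pos.mp hpos
  exact Set.mem_iUnion.mpr ⟨e, (mem_filter.mp he).2⟩

/-- Each element of `s` is among the two earliest with probability at most `2 / #s`. -/
lemma uniformTimes_rank_le_two {s : Finset E} {e : E} (he : e ∈ s) :
    uniformTimes E {U | arrivals s U (U e) ≤ 2} ≤ 2 / #s := by
  let R : E → Set (E → ℝ) := fun f => {U | arrivals s U (U f) ≤ 2}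
  have hm : ∀ f, MeasurableSet (R f) := fun f =>
    measurableSet_le (measurable_id.arrivals s (measurable_pi_apply f)) measurable_const
  -- Transposing the times of `e` and `f` preserves the law, so all ranks are equally distributed.
  have heq : ∀ f ∈ s, uniformTimes E (R f) = uniformTimes E (R e) := by
    intro f hf
    rw [← (uniformTimes_reindex (Equiv.swap e f)).measure_preimage (hm e).nullMeasurableSet]
    congr 1
    ext U
    simp only [R, Set.mem_ofPred_eq, Set.mem_preimage, Function.comp, Equiv.swap_apply_left]
    have hc : arrivals s U (U f) = arrivals s (fun g => U (Equiv.swap e f g)) (U f) := by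
      refine card_bij (fun g _ => Equiv.swap e f g) ?_ (fun _ _ _ _ h => (Equiv.swap e f).injective h)
        ?_
      · intro g hg
        rw [mem_filter] at hg ⊢
        refine ⟨?_, by simpa using hg.2⟩
        rw [Equiv.swap_apply_def]
        split_ifs <;> simp_all
      · intro g hg
        refine ⟨Equiv.swap e f g, ?_, by simp⟩
        rw [mem_filter] at hg ⊢
        refine ⟨?_, hg.2⟩
        rw [Equiv.swap_apply_def]
        split_ifs <;> simp_all
    rw [hc]; rfl
  -- The latest element of rank at most two has all the others counted in its own rank, which also
  -- covers ties.
  have hcount : ∀ U : E → ℝ, #{f ∈ s | U ∈ R f} ≤ 2 := by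
    intro U
    by_contra! h
    have hne : ({f ∈ s | U ∈ R f}).Nonempty := card_pos.mp (by omega)
    obtain ⟨f, hf, hmax⟩ := exists_max_image _ U hne
    have h2 : arrivals s U (U f) ≤ 2 := (mem_filter.mp hf).2
    have h3 : #{f ∈ s | U ∈ R f} ≤ arrivals s U (U f) :=
      card_le_card fun g hg => mem_filter.mpr ⟨(mem_filter.mp hg).1, hmax g hg⟩
    omega
  have hsum : ∑ f ∈ s, uniformTimes E (R f) ≤ 2 := by
    calc ∑ f ∈ s, uniformTimes E (R f)
        = ∫⁻ U, ∑ f ∈ s, (R f).indicator 1 U ∂uniformTimes E := by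
          rw [lintegral_finsetSum _ fun f _ => measurable_one.indicator (hm f)]
          exact sum_congr rfl fun f _ => (lintegral_indicator_one (hm f)).symm
      _ ≤ ∫⁻ _, 2 ∂uniformTimes E := by
          refine lintegral_mono fun U => ?_
          have := hcount U
          simp only [Set.indicator_apply, Pi.one_apply, sum_boole]
          exact_mod_cast this
      _ = 2 := by simp
  rw [sum_congr rfl heq, sum_const, nsmul_eq_mul] at hsum
  rw [ENNReal.le_div_iff_mul_le (Or.inl (by simpa using ne_empty_of_mem he)) (Or.inl (by simp)),
    mul_comm]
  exact hsum

end Arrivals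

/-! ### Binomial estimates -/

section Bounds

variable {E : Type*} [DecidableEq E] [Fintype E]

lemma uniformTimes_arrivals_le (s : Finset E) {t : ℝ} (h0 : 0 ≤ t) (h1 : t ≤ 1) (k : ℕ) :
    uniformTimes E {U | arrivals s U t ≤ k} ≤
      ENNReal.ofReal (∑ j ∈ range (k + 1), (#s).choose j * (t ^ j * (1 - t) ^ (#s - j))) := by
  have hsub : {U : E → ℝ | arrivals s U t ≤ k} ⊆ ⋃ j ∈ range (k + 1), {U | arrivals s U t = j} := by
    intro U hU
    exact Set.mem_iUnion₂.mpr ⟨_, mem_range.mpr (Nat.lt_succ_of_le hU), rfl⟩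
  refine (measure_mono hsub).trans ((measure_biUnion_finset_le _ _).trans_eq ?_)
  have h1' : 0 ≤ 1 - t := by linarith
  rw [ENNReal.ofReal_sum_of_nonneg fun j _ => by positivity]
  exact sum_congr rfl fun j _ => uniformTimes_arrivals_eq s h0 h1 j

/-- Puts the tail in terms of `n * t` even when `m` is slightly below `n`: the exponent equals `-t *
(m - k)`, and `1 ≤ n * t` lets every power be raised to the `k`-th. -/
lemma sum_binomial_le_exp {m n k : ℕ} (hmn : m ≤ n) {t : ℝ} (h0 : 0 ≤ t) (h1 : t ≤ 1)
    (hnt : 1 ≤ n * t) :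
    ∑ j ∈ range (k + 1), (m.choose j * (t ^ j * (1 - t) ^ (m - j)) : ℝ) ≤
      (k + 1) * ((n * t) ^ k * Real.exp (t * (n - m + k) - n * t)) := by
  have hterm : ∀ j ∈ range (k + 1), (m.choose j * (t ^ j * (1 - t) ^ (m - j)) : ℝ) ≤
      (n * t) ^ k * Real.exp (t * (n - m + k) - n * t) := by
    intro j hj
    have hjk : j ≤ k := Nat.lt_succ_iff.mp (mem_range.mp hj)
    have hchoose : (m.choose j : ℝ) ≤ (n : ℝ) ^ j := by
      have : m.choose j ≤ n ^ j :=
        (Nat.choose_le_pow m j).trans (Nat.pow_le_pow_left hmn j)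
      exact_mod_cast this
    have hexp : (1 - t) ^ (m - j) ≤ Real.exp (t * (n - m + k) - n * t) := by
      calc (1 - t) ^ (m - j) ≤ Real.exp (-t) ^ (m - j) :=
            pow_le_pow_left₀ (by linarith) (Real.one_sub_le_exp_neg t) _
        _ = Real.exp (((m - j : ℕ) : ℝ) * -t) := (Real.exp_nat_mul _ _).symm
        _ ≤ _ := by
            apply Real.exp_le_exp.mpr
            have h1 : (m : ℝ) ≤ (m - j : ℕ) + k := by
              have : m ≤ (m - j) + k := by omega
              exact_mod_cast this
            nlinarith
    calc (m.choose j * (t ^ j * (1 - t) ^ (m - j)) : ℝ)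
        ≤ (n : ℝ) ^ j * (t ^ j * Real.exp (t * (n - m + k) - n * t)) := by gcongr
      _ = (n * t) ^ j * Real.exp (t * (n - m + k) - n * t) := by rw [mul_pow]; ring
      _ ≤ _ := by gcongr
  refine (sum_le_card_nsmul _ _ _ hterm).trans_eq ?_
  rw [card_range, nsmul_eq_mul]; push_cast; ring

/-- The ratio of the binomial weights at 2 and 1 is (#s - 1)t / (2(1 - t)), increasing in t. This
ratio is the source of the main term (log n)/2. -/
lemma uniformTimes_two_le_one {s : Finset E} (hs : 2 ≤ #s) {t τ : ℝ} (ht : t ≤ τ) (hτ : τ < 1) :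
    uniformTimes E {U | arrivals s U t = 2} ≤
      ENNReal.ofReal ((#s - 1) * τ / (2 * (1 - τ))) *
        uniformTimes E {U | arrivals s U t ≤ 1} := by
  rcases lt_or_ge t 0 with h | h0
  · rw [uniformTimes_arrivals_eq_zero_of_neg s h two_ne_zero]; exact zero_le
  have h1 : t ≤ 1 := by linarith
  have hs' : (2 : ℝ) ≤ #s := by exact_mod_cast hs
  have hle : uniformTimes E {U | arrivals s U t = 1} ≤ uniformTimes E {U | arrivals s U t ≤ 1} :=
    measure_mono fun U hU => le_of_eq hU
  refine le_trans ?_ (mul_le_mul_right hle _)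
  rw [uniformTimes_arrivals_eq s h0 h1, uniformTimes_arrivals_eq s h0 h1,
    ← ENNReal.ofReal_mul (div_nonneg (mul_nonneg (by linarith) (by linarith)) (by linarith))]
  apply ENNReal.ofReal_le_ofReal
  obtain ⟨m, hm⟩ := Nat.exists_eq_add_of_le hs
  rw [hm, Nat.cast_choose_two, show 2 + m - 2 = m by omega, show 2 + m - 1 = m + 1 by omega]
  push_cast
  rw [div_mul_eq_mul_div, div_mul_eq_mul_div, le_div_iff₀ (show 0 < 2 * (1 - τ) by linarith)]
  have h1t : 0 ≤ 1 - t := by linarith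
  have hcore : t * (1 - τ) ≤ τ * (1 - t) := by linarith
  have hw : 0 ≤ (2 + m : ℝ) * (m + 1) * t * (1 - t) ^ m := by positivity
  rw [Nat.choose_one_right]
  push_cast
  calc _ = (2 + m : ℝ) * (m + 1) * t * (1 - t) ^ m * (t * (1 - τ)) := by ring
    _ ≤ (2 + m : ℝ) * (m + 1) * t * (1 - t) ^ m * (τ * (1 - t)) := by gcongr
    _ = _ := by ring

end Bounds

/-! ### The time at which every set of a family has two arrivals -/

section LastTime

variable {E ι : Type*}

/-- The first time at which every `J u` with `u ∈ F` has two arrivals. -/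
noncomputable def lastSecondTime (F : Finset ι) (J : ι → Finset E) (U : E → ℝ) : ℝ :=
  if h : F.Nonempty then F.sup' h fun u => secondTime (J u) U else 0

variable {F : Finset ι} {J : ι → Finset E}

lemma lastSecondTime_le_iff (hF : F.Nonempty) (hJ : ∀ u ∈ F, 2 ≤ #(J u)) {U : E → ℝ} {t : ℝ} :
    lastSecondTime F J U ≤ t ↔ ∀ u ∈ F, 2 ≤ arrivals (J u) U t := by
  rw [lastSecondTime, dif_pos hF, sup'_le_iff]
  exact forall₂_congr fun u hu => secondTime_le_iff (hJ u hu)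

lemma exists_secondTime_eq (hF : F.Nonempty) (U : E → ℝ) :
    ∃ u ∈ F, secondTime (J u) U = lastSecondTime F J U := by
  rw [lastSecondTime, dif_pos hF]
  obtain ⟨u, hu, h⟩ := exists_mem_eq_sup' hF fun u => secondTime (J u) U
  exact ⟨u, hu, h.symm⟩

lemma lastSecondTime_congr {U U' : E → ℝ} (h : ∀ u ∈ F, ∀ e ∈ J u, U e = U' e) :
    lastSecondTime F J U = lastSecondTime F J U' := by
  unfold lastSecondTime
  split_ifs with hF
  · exact sup'_congr hF rfl fun u hu => secondTime_congr (h u hu)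
  · rfl

lemma measurable_lastSecondTime (hF : F.Nonempty) (hJ : ∀ u ∈ F, 2 ≤ #(J u)) :
    Measurable (lastSecondTime F J) := by
  refine measurable_of_Iic fun t => ?_
  have : lastSecondTime F J ⁻¹' Set.Iic t = ⋂ u ∈ F, {U | 2 ≤ arrivals (J u) U t} := by
    ext U
    simp only [Set.mem_preimage, Set.mem_Iic, Set.mem_iInter, Set.mem_ofPred_eq]
    exact lastSecondTime_le_iff hF hJ
  rw [this]
  exact F.measurableSet_biInter fun u _ =>
    measurableSet_le measurable_const (measurable_id.arrivals _ measurable_const)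

end LastTime

/-! ### Expected number of low-degree vertices -/

section Incidence

variable {V E : Type*} [Fintype V] [DecidableEq V] [Fintype E] [DecidableEq E]

/-- Incidence sets of a complete graph on `d + 1` vertices. -/
structure IsCompleteIncidence (I : V → Finset E) (d : ℕ) : Prop where
  card_vertex : Fintype.card V = d + 1
  card_edge : ∀ v, #(I v) = d
  card_inter : ∀ u v, u ≠ v → #(I u ∩ I v) = 1

/-- The first time at which all the vertices other than `v` have degree two after deleting `v`. -/
noncomputable def othersTime (I : V → Finset E) (v : V) (U : E → ℝ) : ℝ :=
  lastSecondTime (univ.erase v) (fun u => I u \ I v) U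

/-- At some time `v` has degree at most two while the other vertices have degree at least two. -/
def lowDegreeEvent (I : V → Finset E) (v : V) : Set (E → ℝ) :=
  {U | ∃ t, arrivals (I v) U t ≤ 2 ∧ ∀ u, u ≠ v → 2 ≤ arrivals (I u) U t}

/-- The edges joining `v` to the last vertices of the rest of the graph are among its first two. -/
def earlyLinkEvent (I : V → Finset E) (v : V) : Set (E → ℝ) :=
  {U | ∀ u, u ≠ v → secondTime (I u \ I v) U = othersTime I v U →
    ∀ e ∈ I u ∩ I v, arrivals (I v) U (U e) ≤ 2}

variable {I : V → Finset E} {d : ℕ}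

namespace IsCompleteIncidence

variable (hI : IsCompleteIncidence I d) (hd : 3 ≤ d)
include hI

omit [DecidableEq V] [Fintype E] in
lemma card_sdiff {u v : V} (h : u ≠ v) : #(I u \ I v) = d - 1 := by
  have h1 := card_sdiff_add_card_inter (I u) (I v)
  rw [hI.card_inter u v h, hI.card_edge u] at h1
  omega

include hd

omit [Fintype E] in
lemma erase_nonempty (v : V) : (univ.erase v).Nonempty := by
  rw [← card_pos, card_erase_of_mem (mem_univ v), card_univ, hI.card_vertex]; omega

omit [Fintype E] in
lemma two_le_card_sdiff (v : V) : ∀ u ∈ univ.erase v, 2 ≤ #(I u \ I v) := by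
  intro u hu
  rw [hI.card_sdiff (ne_of_mem_erase hu)]; omega

omit [Fintype E] in
lemma othersTime_le_iff {v : V} {U : E → ℝ} {t : ℝ} :
    othersTime I v U ≤ t ↔ ∀ u, u ≠ v → 2 ≤ arrivals (I u \ I v) U t := by
  rw [othersTime, lastSecondTime_le_iff (hI.erase_nonempty hd v) (hI.two_le_card_sdiff hd v)]
  simp

omit [Fintype E] in
lemma measurable_othersTime (v : V) : Measurable (othersTime I v) :=
  measurable_lastSecondTime (hI.erase_nonempty hd v) (hI.two_le_card_sdiff hd v)

omit hI hd [Fintype E] in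
lemma othersTime_congr {v : V} {U U' : E → ℝ} (h : ∀ e ∉ I v, U e = U' e) :
    othersTime I v U = othersTime I v U' :=
  lastSecondTime_congr fun _ _ e he => h e (mem_sdiff.mp he).2

omit [Fintype E] in
lemma lowDegreeEvent_subset (v : V) (τ : ℝ) :
    lowDegreeEvent I v ⊆
      ({U | arrivals (I v) U (othersTime I v U) ≤ 1} ∪
        {U | arrivals (I v) U (othersTime I v U) = 2 ∧ othersTime I v U ≤ τ}) ∪
      ((⋃ u ∈ univ.erase v, {U | arrivals (I v) U τ ≤ 2 ∧ arrivals (I u \ I v) U τ ≤ 1}) ∪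
        earlyLinkEvent I v) := by
  rintro U ⟨t, hv, hu⟩
  rcases le_or_gt (othersTime I v U) t with hM | hM
  · have hle := (arrivals_mono subset_rfl U hM).trans hv
    rcases hle.lt_or_eq with h1 | h2
    · exact Or.inl (Or.inl (Nat.lt_succ_iff.mp h1))
    rcases le_or_gt (othersTime I v U) τ with hτ | hτ
    · exact Or.inl (Or.inr ⟨h2, hτ⟩)
    -- At time `τ` some `u` still lacks a second edge avoiding `v`, and `v` has no more edges than
    -- at the later time `othersTime`.
    · right; left
      have := mt (hI.othersTime_le_iff hd).mpr hτ.not_ge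
      push Not at this
      obtain ⟨u, huv, hlt⟩ := this
      refine Set.mem_iUnion₂.mpr ⟨u, mem_erase.mpr ⟨huv, mem_univ u⟩, ?_, Nat.lt_succ_iff.mp hlt⟩
      exact (arrivals_mono subset_rfl U hτ.le).trans h2.le
  -- At time `t` the last vertex `u` has at most one edge avoiding `v`, so its second must be the
  -- edge `uv`, present while `v` has at most two edges.
  · right; right
    intro u huv heq e he
    have hcard : 2 ≤ #(I u \ I v) := hI.two_le_card_sdiff hd v u (mem_erase.mpr ⟨huv, mem_univ u⟩)
    have hlt : arrivals (I u \ I v) U t < 2 := by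
      by_contra h
      exact hM.not_ge (heq ▸ (secondTime_le_iff hcard).mpr (not_lt.mp h))
    have hex : ∃ f ∈ I u ∩ I v, U f ≤ t := by
      by_contra! h
      have : arrivals (I u) U t ≤ arrivals (I u \ I v) U t := by
        refine card_le_card fun f hf => ?_
        rw [mem_filter] at hf ⊢
        refine ⟨mem_sdiff.mpr ⟨hf.1, fun hfv => ?_⟩, hf.2⟩
        exact absurd hf.2 (h f (mem_inter.mpr ⟨hf.1, hfv⟩)).not_ge
      have := hu u huv
      omega
    obtain ⟨f, hf, hft⟩ := hex
    rw [card_le_one.mp (hI.card_inter u v huv).le e he f hf]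
    exact (arrivals_mono subset_rfl U hft).trans hv

/-- The edges avoiding `v` determine a last vertex `u`. Given them, `uv` is a fixed one of the `d`
edges at `v`, whose times are independent of them. -/
lemma measure_earlyLinkEvent (v : V) : uniformTimes E (earlyLinkEvent I v) ≤ 2 / d := by
  let S : Set ((E → ℝ) × (E → ℝ)) := {z | ∀ u, u ≠ v →
    secondTime (I u \ I v) z.2 = othersTime I v z.2 →
      ∀ e ∈ I u ∩ I v, arrivals (I v) z.1 (z.1 e) ≤ 2}
  have hS : MeasurableSet S := by
    have heq : S = ⋂ u ∈ univ.erase v,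
        ({z | secondTime (I u \ I v) z.2 = othersTime I v z.2}ᶜ ∪
          ⋂ e ∈ I u ∩ I v, {z | arrivals (I v) z.1 (z.1 e) ≤ 2}) := by
      ext z
      simp only [S, Set.mem_iInter, Set.mem_union, Set.mem_compl_iff, Set.mem_ofPred_eq,
        mem_erase, mem_univ, and_true, imp_iff_not_or]
    rw [heq]
    refine (univ.erase v).measurableSet_biInter fun u hu => ?_
    refine (measurableSet_eq_fun ((measurable_secondTime (hI.two_le_card_sdiff hd v u hu)).comp
      measurable_snd) ((hI.measurable_othersTime hd v).comp measurable_snd)).compl.union ?_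
    exact (I u ∩ I v).measurableSet_biInter fun e _ => measurableSet_le
      (measurable_fst.arrivals _ ((measurable_pi_apply e).comp measurable_fst)) measurable_const
  have hdiag := uniformTimes_diag (I v) hS (by
    intro x x' y y' hx hy
    refine forall₂_congr fun u _ => ?_
    have h1 : secondTime (I u \ I v) y = secondTime (I u \ I v) y' :=
      secondTime_congr fun e he => hy e (mem_sdiff.mp he).2
    have h2 : othersTime I v y = othersTime I v y' := othersTime_congr hy
    have h3 : ∀ e ∈ I u ∩ I v, arrivals (I v) x (x e) = arrivals (I v) x' (x' e) := by
      intro e he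
      rw [hx e (mem_inter.mp he).2, arrivals_congr hx]
    simp only [h1, h2]
    exact imp_congr_right fun _ => forall₂_congr fun e he => by rw [h3 e he])
  have heq : earlyLinkEvent I v = {U | (U, U) ∈ S} := rfl
  rw [heq, hdiag]
  calc ∫⁻ y, uniformTimes E {x | (x, y) ∈ S} ∂uniformTimes E
      ≤ ∫⁻ _, 2 / d ∂uniformTimes E := by
        refine lintegral_mono fun y => ?_
        obtain ⟨u, hu, huy⟩ := exists_secondTime_eq (J := fun u => I u \ I v)
          (hI.erase_nonempty hd v) y
        have huv := ne_of_mem_erase hu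
        obtain ⟨e, he⟩ := card_pos.mp (by rw [hI.card_inter u v huv]; exact one_pos)
        have := uniformTimes_rank_le_two (mem_inter.mp he).2
        rw [hI.card_edge v] at this
        exact (measure_mono fun x (hx : (x, y) ∈ S) => hx u huv huy e he).trans this
    _ = 2 / d := by simp

/-- Conditionally on the edges avoiding `v`, `othersTime` is a constant and the binomial comparison
applies pointwise. -/
lemma measure_eq_two_le (v : V) {τ : ℝ} (hτ : τ < 1) :
    uniformTimes E {U | arrivals (I v) U (othersTime I v U) = 2 ∧ othersTime I v U ≤ τ} ≤
      ENNReal.ofReal ((d - 1) * τ / (2 * (1 - τ))) *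
        uniformTimes E {U | arrivals (I v) U (othersTime I v U) ≤ 1} := by
  have hM := hI.measurable_othersTime hd v
  have harr : Measurable fun z : (E → ℝ) × (E → ℝ) => arrivals (I v) z.1 (othersTime I v z.2) :=
    measurable_fst.arrivals _ (hM.comp measurable_snd)
  have h1 := uniformTimes_diag (I v)
    (S := {z | arrivals (I v) z.1 (othersTime I v z.2) = 2 ∧ othersTime I v z.2 ≤ τ})
    ((measurableSet_eq_fun harr measurable_const).inter
      (measurableSet_le (hM.comp measurable_snd) measurable_const)) (by
        intro x x' y y' hx hy
        simp only [Set.mem_ofPred_eq, othersTime_congr hy, arrivals_congr hx])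
  have h2 := uniformTimes_diag (I v) (S := {z | arrivals (I v) z.1 (othersTime I v z.2) ≤ 1})
    (measurableSet_le harr measurable_const) (by
        intro x x' y y' hx hy
        simp only [Set.mem_ofPred_eq, othersTime_congr hy, arrivals_congr hx])
  simp only [Set.mem_ofPred_eq] at h1 h2
  rw [h1, h2, ← lintegral_const_mul' _ _ ENNReal.ofReal_ne_top]
  refine lintegral_mono fun y => ?_
  by_cases hy : othersTime I v y ≤ τ
  · have := uniformTimes_two_le_one (s := I v) (by rw [hI.card_edge v]; omega) hy hτ
    rw [hI.card_edge v] at this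
    simpa [hy] using this
  · simp [hy]

/-- The events are disjoint: if `a` has the smaller `othersTime`, then any other `b` has two edges
avoiding `a` by that time, hence by its own. -/
lemma sum_measure_le_one :
    ∑ v, uniformTimes E {U | arrivals (I v) U (othersTime I v U) ≤ 1} ≤ 1 := by
  rw [← measure_biUnion_finset]
  · exact prob_le_one
  · intro v _ w _ hvw
    refine Set.disjoint_left.mpr fun U hv hw => ?_
    have key : ∀ a b : V, a ≠ b → othersTime I a U ≤ othersTime I b U →
        ¬ arrivals (I b) U (othersTime I b U) ≤ 1 := by
      intro a b hab hle hb
      have h2 := (hI.othersTime_le_iff hd).mp (le_refl (othersTime I a U)) b hab.symm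
      have := arrivals_mono (sdiff_subset (s := I b) (t := I a)) U hle
      omega
    rcases le_total (othersTime I v U) (othersTime I w U) with h | h
    · exact key v w hvw h hw
    · exact key w v hvw.symm h hv
  · intro v _
    exact measurableSet_le (measurable_id.arrivals _ (hI.measurable_othersTime hd v))
      measurable_const

/-- The expected number of vertices of low degree when all the others reach degree two. -/
theorem sum_measure_lowDegreeEvent_le {τ : ℝ} (h0 : 0 ≤ τ) (h1 : τ < 1)
    (hτ : 1 ≤ (d + 1) * τ) :
    ∑ v, (uniformTimes E).real (lowDegreeEvent I v) ≤
      1 + (d - 1) * τ / (2 * (1 - τ)) +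
        (d + 1) * d * (6 * ((d + 1) * τ) ^ 3 * Real.exp (6 * τ - 2 * ((d + 1) * τ))) +
        2 * (d + 1) / d := by
  set n : ℕ := d + 1 with hn
  have hnd : (n : ℝ) = d + 1 := by rw [hn]; push_cast; ring
  rw [← hnd] at hτ ⊢
  have hd1 : (1 : ℝ) ≤ d := by exact_mod_cast (by omega : 1 ≤ d)
  set μ := uniformTimes E
  set r : ℝ := (d - 1) * τ / (2 * (1 - τ)) with hr
  have hr0 : 0 ≤ r := div_nonneg (mul_nonneg (by linarith) h0) (by linarith)
  let p : V → ℝ := fun v => μ.real {U | arrivals (I v) U (othersTime I v U) ≤ 1}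
  have hp : ∑ v, p v ≤ 1 := by
    have := ENNReal.toReal_mono ENNReal.one_ne_top (hI.sum_measure_le_one hd)
    rwa [ENNReal.toReal_sum fun _ _ => measure_ne_top _ _, ENNReal.toReal_one] at this
  have htwo : ∀ v, μ.real {U | arrivals (I v) U (othersTime I v U) = 2 ∧ othersTime I v U ≤ τ} ≤
      r * p v := by
    intro v
    have := ENNReal.toReal_mono (ENNReal.mul_ne_top ENNReal.ofReal_ne_top (measure_ne_top _ _))
      (hI.measure_eq_two_le hd v h1)
    rwa [ENNReal.toReal_mul, ENNReal.toReal_ofReal hr0] at this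
  have hlink : ∀ v, μ.real (earlyLinkEvent I v) ≤ 2 / d := by
    intro v
    have := ENNReal.toReal_mono (ENNReal.div_ne_top (by simp) (by simp; omega))
      (hI.measure_earlyLinkEvent hd v)
    rwa [ENNReal.toReal_div, ENNReal.toReal_ofNat, ENNReal.toReal_natCast] at this
  have hle : ∀ (s : Finset E) (k : ℕ), #s ≤ n → μ.real {U | arrivals s U τ ≤ k} ≤
      (k + 1) * ((n * τ) ^ k * Real.exp (τ * (n - #s + k) - n * τ)) := by
    intro s k hs
    refine (ENNReal.toReal_le_of_le_ofReal ?_ (uniformTimes_arrivals_le s h0 h1.le k)).trans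
      (sum_binomial_le_exp hs h0 h1.le hτ)
    have : 0 ≤ 1 - τ := by linarith
    positivity
  have hpair : ∀ v, ∀ u ∈ univ.erase v,
      μ.real {U | arrivals (I v) U τ ≤ 2 ∧ arrivals (I u \ I v) U τ ≤ 1} ≤
        6 * (n * τ) ^ 3 * Real.exp (6 * τ - 2 * (n * τ)) := by
    intro v u hu
    have huv := ne_of_mem_erase hu
    have hprod := congrArg ENNReal.toReal
      (uniformTimes_inter (disjoint_sdiff (s := I v) (t := I u)) τ 2 1)
    rw [ENNReal.toReal_mul] at hprod
    refine hprod.trans_le ?_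
    have ha := hle (I v) 2 (by rw [hI.card_edge v]; omega)
    have hb := hle (I u \ I v) 1 (by rw [hI.card_sdiff huv]; omega)
    rw [hI.card_edge v] at ha
    rw [hI.card_sdiff huv, Nat.cast_sub (by omega : 1 ≤ d)] at hb
    -- The 6 is 3 · 2 from the two tails; each exponent carries a correction `3 * τ`.
    calc μ.real {U | arrivals (I v) U τ ≤ 2} * μ.real {U | arrivals (I u \ I v) U τ ≤ 1}
        ≤ _ := mul_le_mul ha hb measureReal_nonneg (by positivity)
      _ = 6 * (n * τ) ^ 3 * (Real.exp (τ * (n - d + (2 : ℕ)) - n * τ) *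
            Real.exp (τ * (n - (d - (1 : ℕ)) + (1 : ℕ)) - n * τ)) := by push_cast; ring
      _ = _ := by
          rw [← Real.exp_add, hnd]
          congr 2
          push_cast; ring
  have hv : ∀ v, μ.real (lowDegreeEvent I v) ≤ (1 + r) * p v +
      (d * (6 * (n * τ) ^ 3 * Real.exp (6 * τ - 2 * (n * τ))) + 2 / d) := by
    intro v
    refine (measureReal_mono (hI.lowDegreeEvent_subset hd v τ)).trans ?_
    refine (measureReal_union_le _ _).trans (add_le_add ?_ ?_)
    · refine (measureReal_union_le _ _).trans ?_
      have := htwo v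
      have hpv : p v = μ.real {U | arrivals (I v) U (othersTime I v U) ≤ 1} := rfl
      linarith
    · refine (measureReal_union_le _ _).trans (add_le_add ?_ (hlink v))
      refine (measureReal_biUnion_finset_le _ _).trans ?_
      refine (sum_le_card_nsmul _ _ _ (hpair v)).trans_eq ?_
      rw [card_erase_of_mem (mem_univ v), card_univ, hI.card_vertex, Nat.add_sub_cancel,
        nsmul_eq_mul]
  refine (sum_le_sum fun v _ => hv v).trans ?_
  rw [sum_add_distrib, ← mul_sum, sum_const, card_univ, hI.card_vertex, ← hn, nsmul_eq_mul]
  have : (1 + r) * ∑ v, p v ≤ (1 + r) * 1 := mul_le_mul_of_nonneg_left hp (by linarith)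
  have h2 : (n : ℝ) * (2 / d) = 2 * n / d := by ring
  rw [mul_add, h2]
  linarith

end IsCompleteIncidence

end Incidence

/-! ### Application to the edge process on K_n -/

section CompleteGraph

variable {n : ℕ}

open Classical in
/-- The edges of `K_n` incident to `v`. -/
noncomputable def incidentEdges (n : ℕ) (v : Fin n) : Finset (CompleteEdge n) :=
  {e | v ∈ (e : Sym2 (Fin n))}

lemma mem_incidentEdges {v : Fin n} {e : CompleteEdge n} :
    e ∈ incidentEdges n v ↔ v ∈ (e : Sym2 (Fin n)) := by
  simp [incidentEdges]

/-- The degree of `v` in a graph is the number of edges of `K_n` at `v` in the graph. -/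
lemma card_incidentEdges_filter (G : SimpleGraph (Fin n)) (v : Fin n) (p : CompleteEdge n → Prop)
    [DecidablePred p] [Fintype (G.neighborSet v)]
    (h : ∀ e : CompleteEdge n, (e : Sym2 (Fin n)) ∈ G.edgeSet ↔ p e) :
    #{e ∈ incidentEdges n v | p e} = G.degree v := by
  classical
  rw [← G.card_neighborFinset_eq_degree]
  symm
  refine card_bij (fun w hw => ⟨s(v, w), by
    rw [SimpleGraph.mem_neighborFinset] at hw; simpa using hw.ne⟩) ?_ ?_ ?_
  · intro w hw
    rw [SimpleGraph.mem_neighborFinset] at hw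
    rw [mem_filter, mem_incidentEdges, ← h]
    exact ⟨Sym2.mem_mk_left v w, hw⟩
  · intro w hw w' hw' heq
    exact Sym2.congr_right.mp (congrArg Subtype.val heq)
  · rintro ⟨e, he⟩ hep
    rw [mem_filter, mem_incidentEdges, ← h] at hep
    obtain ⟨w, rfl⟩ := Sym2.mem_iff_exists.mp hep.1
    exact ⟨w, by rw [SimpleGraph.mem_neighborFinset]; exact hep.2, rfl⟩

lemma isCompleteIncidence_incidentEdges {d : ℕ} :
    IsCompleteIncidence (incidentEdges (d + 1)) d := by
  refine ⟨Fintype.card_fin _, fun v => ?_, fun u v huv => ?_⟩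
  · have := card_incidentEdges_filter (⊤ : SimpleGraph (Fin (d + 1))) v (fun _ => True)
      fun e => iff_of_true e.2 trivial
    rw [filter_true] at this
    rw [this]; simp
  · rw [card_eq_one]
    refine ⟨⟨s(u, v), by simpa using huv⟩, ?_⟩
    ext e
    rw [mem_inter, mem_incidentEdges, mem_incidentEdges, mem_singleton, Subtype.ext_iff,
      Sym2.mem_and_mem_iff huv]

lemma mem_edgeSet_edgeProcess (σ : EdgeOrdering n) (m : ℕ) (e : CompleteEdge n) :
    (e : Sym2 (Fin n)) ∈ (edgeProcess σ m).edgeSet ↔ (σ.symm e : ℕ) < m := by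
  rw [edgeProcess, SimpleGraph.edgeSet_fromEdgeSet, Set.mem_sdiff]
  constructor
  · rintro ⟨⟨i, hi, hie⟩, -⟩
    have : σ i = e := Subtype.ext hie
    rwa [← this, Equiv.symm_apply_apply]
  · intro h
    refine ⟨⟨σ.symm e, h, by simp⟩, ?_⟩
    have := e.2
    exact (⊤ : SimpleGraph (Fin n)).not_isDiag_of_mem_edgeSet this

open Classical in
lemma two_le_minDegree_bollobasGraph (hn : 3 ≤ n) (σ : EdgeOrdering n) :
    2 ≤ (bollobasGraph σ).minDegree := by
  have hne : {m : ℕ | 2 ≤ (edgeProcess σ m).minDegree}.Nonempty := by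
    refine ⟨n.choose 2, ?_⟩
    have htop : edgeProcess σ (n.choose 2) = ⊤ := by
      rw [← SimpleGraph.edgeSet_inj]
      refine Set.Subset.antisymm (SimpleGraph.edgeSet_mono le_top) fun e he => ?_
      exact (mem_edgeSet_edgeProcess σ _ ⟨e, he⟩).mpr (Fin.is_lt _)
    have : Nonempty (Fin n) := ⟨⟨0, by omega⟩⟩
    change 2 ≤ (edgeProcess σ (n.choose 2)).minDegree
    refine SimpleGraph.le_minDegree_of_forall_le_degree _ _ fun v => ?_
    have hdeg : ∀ (G : SimpleGraph (Fin n)) [Fintype (G.neighborSet v)], G = ⊤ →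
        G.degree v = Fintype.card (Fin n) - 1 := by
      rintro G _ rfl
      convert SimpleGraph.complete_graph_degree v
    rw [hdeg _ htop, Fintype.card_fin]
    omega
  exact Nat.sInf_mem hne

open Classical in
/-- A vertex of degree two in the Bollobás random graph has low degree at some time, when the
edges are ordered by their times. -/
lemma mem_lowDegreeEvent (hn : 3 ≤ n) {σ : EdgeOrdering n} {U : CompleteEdge n → ℝ}
    (hU : StrictMono (U ∘ σ)) {v : Fin n} (hv : (bollobasGraph σ).degree v = 2) :
    U ∈ lowDegreeEvent (incidentEdges n) v := by
  set m := hittingTime σ with hm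
  have hdeg : ∀ u, #{e ∈ incidentEdges n u | (σ.symm e : ℕ) < m} = (bollobasGraph σ).degree u :=
    fun u => card_incidentEdges_filter _ u _ (mem_edgeSet_edgeProcess σ m)
  have hne : ({e | (σ.symm e : ℕ) < m} : Finset (CompleteEdge n)).Nonempty := by
    rw [← card_pos]
    have h1 : #{e ∈ incidentEdges n v | (σ.symm e : ℕ) < m} ≤
        #({e | (σ.symm e : ℕ) < m} : Finset (CompleteEdge n)) :=
      card_le_card (filter_subset_filter _ (subset_univ _))
    have := hdeg v
    omega
  obtain ⟨f, hf, hmax⟩ := exists_max_image _ U hne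
  have harr : ∀ u, arrivals (incidentEdges n u) U (U f) = (bollobasGraph σ).degree u := by
    intro u
    rw [← hdeg u, arrivals]
    congr 1
    refine filter_congr fun e _ => ⟨fun h => ?_, fun h => hmax e (by simpa using h)⟩
    have h' : (U ∘ σ) (σ.symm e) ≤ (U ∘ σ) (σ.symm f) := by simpa using h
    exact lt_of_le_of_lt (Fin.le_def.mp (hU.le_iff_le.mp h')) (mem_filter.mp hf).2
  refine ⟨U f, by rw [harr, hv], fun u _ => ?_⟩
  rw [harr]
  exact (two_le_minDegree_bollobasGraph hn σ).trans (SimpleGraph.minDegree_le_degree _ u)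

lemma nonempty_edgeOrdering (n : ℕ) : Nonempty (EdgeOrdering n) := by
  classical
  refine ⟨(Fintype.equivFinOfCardEq ?_).symm⟩
  have := SimpleGraph.card_edgeFinset_top_eq_card_choose_two (V := Fin n)
  rw [Fintype.card_fin] at this
  rw [← this, SimpleGraph.edgeFinset_card]

open Classical in
-- Counting pairs (ordering, vertex) by vertex cancels the factor `n`, leaving the expected number
-- of degree-two vertices.
lemma mul_probDegreeTwo_le (hn : 3 ≤ n) :
    n * probDegreeTwo n ≤
      ∑ v, (uniformTimes (CompleteEdge n)).real (lowDegreeEvent (incidentEdges n) v) := by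
  obtain ⟨τ⟩ := nonempty_edgeOrdering n
  have hsum : n * probDegreeTwo n =
      ∑ v, uniformProb (EdgeOrdering n) {σ | (bollobasGraph σ).degree v = 2} := by
    have hcard : ({p | (bollobasGraph p.1).degree p.2 = 2} : Set (EdgeOrdering n × Fin n)).ncard =
        ∑ v, ({σ | (bollobasGraph σ).degree v = 2} : Set (EdgeOrdering n)).ncard := by
      simp only [Set.ncard_eq_toFinset_card', Set.toFinset_ofPred]
      rw [card_filter, ← univ_product_univ, sum_product_right]
      simp only [card_filter]
    have hn' : (n : ℝ) ≠ 0 := by positivity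
    simp only [probDegreeTwo, uniformProb]
    rw [hcard, ← sum_div, Nat.card_prod, Nat.card_fin]
    push_cast
    rw [mul_comm (Nat.card (EdgeOrdering n) : ℝ), ← div_div, mul_div_assoc', mul_div_assoc',
      mul_div_cancel_left₀ _ hn']
  rw [hsum]
  exact sum_le_sum fun v _ => uniformProb_le_uniformTimes τ _ _ fun σ hσ U hU =>
    mem_lowDegreeEvent hn hU hσ

end CompleteGraph

/-! ### Choice of the cut-off time and asymptotics -/

section Asymptotics

open Filter

/-- The right side expands to (log n)/2 + log log n + (log c₀)/2, and the spare (1/4) log log n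
absorbs any constant. -/
lemma bound_eventually_le (C c₀ : ℝ) (hc₀ : 0 < c₀) :
    ∀ᶠ n : ℕ in atTop, Real.log n / 2 + 3 / 4 * Real.log (Real.log n) + C ≤
      Real.log (c₀ * n * Real.log n ^ 2) / 2 := by
  have hlog : Tendsto (fun n : ℕ => Real.log n) atTop atTop :=
    Real.tendsto_log_atTop.comp tendsto_natCast_atTop_atTop
  have hloglog := Real.tendsto_log_atTop.comp hlog
  filter_upwards [hlog.eventually_gt_atTop 0, eventually_gt_atTop 0,
    hloglog.eventually_ge_atTop (4 * (C - Real.log c₀ / 2))] with n h1 h2 h3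
  have hn : (0 : ℝ) < n := by exact_mod_cast h2
  simp only [Function.comp] at h3
  rw [Real.log_mul (by positivity) (by positivity), Real.log_mul hc₀.ne' hn.ne', Real.log_pow]
  push_cast
  linarith

lemma eventually_sq_log_le : ∀ᶠ n : ℕ in atTop, 18 * Real.log n ^ 2 ≤ n := by
  have h := (Real.isLittleO_pow_log_id_atTop (n := 2)).comp_tendsto tendsto_natCast_atTop_atTop
  filter_upwards [h.def (show (0 : ℝ) < 1 / 18 by norm_num)] with n hn
  simp only [Function.comp, Real.norm_eq_abs, id, abs_of_nonneg (sq_nonneg (Real.log (n : ℝ))),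
    Nat.abs_cast] at hn
  linarith

/-- The bound for the expected number of vertices of degree two, at the cut-off time
`(log n + (3/2) log log n) / n`. -/
lemma cutoff_bound {n : ℕ} (hn : 4 ≤ n) (hL : 1 ≤ Real.log n) (hLn : 18 * Real.log n ^ 2 ≤ n)
    {τ : ℝ} (hτ : n * τ = Real.log n + 3 / 2 * Real.log (Real.log n)) :
    0 ≤ τ ∧ τ < 1 ∧ 1 ≤ n * τ ∧
      1 + (n - 1 - 1) * τ / (2 * (1 - τ)) +
        n * (n - 1) * (6 * (n * τ) ^ 3 * Real.exp (6 * τ - 2 * (n * τ))) + 2 * n / (n - 1) ≤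
      Real.log n / 2 + 3 / 4 * Real.log (Real.log n) + (6 + 162 * Real.exp 3) := by
  set L := Real.log n with hLdef
  have hLL : 0 ≤ Real.log L := Real.log_nonneg hL
  have hLL' : Real.log L ≤ L := Real.log_le_self (by linarith)
  have hn4 : (4 : ℝ) ≤ n := by exact_mod_cast hn
  have hn0 : (0 : ℝ) < n := by linarith
  set x := n * τ with hx
  have hx1 : 1 ≤ x := by rw [hτ]; linarith
  have hx3 : x ≤ 3 * L := by rw [hτ]; linarith
  have hτ0 : 0 ≤ τ := by
    by_contra! h
    nlinarith
  -- The 18 in the hypothesis makes (3L)² ≤ n/2.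
  have hxτ : x * τ ≤ 1 / 2 := by
    have h1 : n * (x * τ) ≤ n * (1 / 2) := by
      calc n * (x * τ) = x ^ 2 := by rw [hx]; ring
        _ ≤ (3 * L) ^ 2 := by gcongr
        _ ≤ n * (1 / 2) := by nlinarith
    exact le_of_mul_le_mul_left h1 hn0
  have hτ2 : τ ≤ 1 / 2 := by nlinarith
  refine ⟨hτ0, by linarith, hx1, ?_⟩
  have hr : (n - 1 - 1) * τ / (2 * (1 - τ)) ≤ x / 2 + 1 := by
    rw [div_le_iff₀ (by linarith)]
    nlinarith
  have hlink : 2 * (n : ℝ) / (n - 1) ≤ 4 := by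
    rw [div_le_iff₀ (by linarith)]; linarith
  -- The coefficient 3/2 of log log n is chosen so that `L ^ 3` here cancels the cubic factor `x ^
  -- 3` in the pair term.
  have hexp : Real.exp (6 * τ - 2 * x) ≤ Real.exp 3 / (n ^ 2 * L ^ 3) := by
    have hpow : Real.exp (2 * x) = n ^ 2 * L ^ 3 := by
      rw [hτ, show 2 * (L + 3 / 2 * Real.log L) = (2 : ℕ) * L + (3 : ℕ) * Real.log L by
        push_cast; ring, Real.exp_add, Real.exp_nat_mul, Real.exp_nat_mul, hLdef,
        Real.exp_log hn0, ← hLdef, Real.exp_log (by linarith)]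
    rw [Real.exp_sub, hpow]
    have : Real.exp (6 * τ) ≤ Real.exp 3 := Real.exp_le_exp.mpr (by linarith)
    gcongr
  have hpair : n * (n - 1) * (6 * x ^ 3 * Real.exp (6 * τ - 2 * x)) ≤ 162 * Real.exp 3 := by
    have hL0 : 0 < L := by linarith
    calc n * (n - 1) * (6 * x ^ 3 * Real.exp (6 * τ - 2 * x))
        ≤ n * n * (6 * (3 * L) ^ 3 * (Real.exp 3 / (n ^ 2 * L ^ 3))) := by
          gcongr
          linarith
      _ = 162 * Real.exp 3 := by field_simp; ring
  have hxe : x / 2 = L / 2 + 3 / 4 * Real.log L := by rw [hτ]; ring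
  -- The constant 6 is 1 + 1 + 4: the initial 1, the error in `hr`, and `hlink`.
  linarith

end Asymptotics

theorem theorem1p3 (c₀ : ℝ) (hc₀ : 0 < c₀) :
    ∃ n₀ : ℕ, ∀ n : ℕ, n₀ ≤ n → ∀ c : ℝ, c₀ ≤ c →
      probDegreeTwo n ≤ Real.log (c * (n : ℝ) * (Real.log (n : ℝ)) ^ 2) / (2 * (n : ℝ)) := by
  have hlog : Filter.Tendsto (fun n : ℕ => Real.log n) Filter.atTop Filter.atTop :=
    Real.tendsto_log_atTop.comp tendsto_natCast_atTop_atTop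
  rw [← Filter.eventually_atTop]
  filter_upwards [bound_eventually_le (6 + 162 * Real.exp 3) c₀ hc₀, eventually_sq_log_le,
    hlog.eventually_ge_atTop 1, Filter.eventually_ge_atTop 4] with n hbound hsq hL hn c hc
  have hn0 : (0 : ℝ) < n := by exact_mod_cast (by omega : 0 < n)
  obtain ⟨h0, h1, hx, hcut⟩ := cutoff_bound hn hL hsq
    (τ := (Real.log n + 3 / 2 * Real.log (Real.log n)) / n) (mul_div_cancel₀ _ hn0.ne')
  obtain ⟨d, rfl⟩ : ∃ d, n = d + 1 := ⟨n - 1, by omega⟩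
  have hd : ((d + 1 : ℕ) : ℝ) - 1 = d := by push_cast; ring
  have hsum := (isCompleteIncidence_incidentEdges (d := d)).sum_measure_lowDegreeEvent_le
    (by omega) h0 h1 (by exact_mod_cast hx)
  rw [hd] at hcut
  rw [Nat.cast_add_one] at *
  -- Monotonicity in `c` reduces to `c₀`, so the threshold does not depend on `c`.
  have hlogle : Real.log (c₀ * (d + 1) * Real.log (d + 1) ^ 2) ≤
      Real.log (c * (d + 1) * Real.log (d + 1) ^ 2) := by
    apply Real.log_le_log (by positivity)
    gcongr
  have hmul := mul_probDegreeTwo_le (n := d + 1) (by omega)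
  rw [Nat.cast_add_one] at hmul
  rw [le_div_iff₀ (by linarith)]
  linarith [hmul.trans (hsum.trans (hcut.trans hbound))]
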